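/- Let $(\Omega,\mathcal F,\mathbb P)$ be a probability space, $\mathcal X=L^1(\Omega,\mathcal F,\mathbb P)$ (random variables that are $\mathbb P$-a.s. equal are identified, and $\mathcal X$ carries the $\mathbb P$-a.s. order), $\Sigma$ the set of sub-$\sigma$-algebras of $\mathcal F$, and $n\ge 3$. For $\boldsymbol X\in\mathcal X^n$, $S\in\mathcal X$ and $\mathcal G\in\Sigma$ put $S^{\boldsymbol X}=\sum_{i=1}^n X_i$, $\mathcal G^S=\sigma\{\mathcal G,\sigma\{S\}\}$ and $\mathcal G^{\boldsymbol X}=\mathcal G^{S^{\boldsymbol X}}$; inclusions $\sigma\{X\}\subseteq\mathcal G$ are understood up to $\mathbb P$-a.s. equality of $X$. Let $\boldsymbol e^{(i)}$ be the $i$-th unit vector, and let $X_m\downarrow X$ mean that $(X_m)$ is decreasing with infimum $X$ in $\mathcal X$. For a map $H:\mathcal X^n\times\Sigma\to\mathcal X^n$ let $\mathcal C^{\boldsymbol X,\mathcal G}_{i,j}(H)=X_i+X_j-H_i(\boldsymbol X|\mathcal G)-H_j(\boldsymbol X|\mathcal G)$. For every map $H:\mathcal X^n\times\Sigma\to\mathcal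 X^n$ the following are equivalent. (i) $H$ is an allocation mechanism, that is, $\sum_{i=1}^n H_i(\boldsymbol X|\mathcal G)\le S^{\boldsymbol X}$ for all $\boldsymbol X\in\mathcal X^n$ and $\mathcal G\in\Sigma$, and for all $\mathcal G\in\Sigma$, $\boldsymbol X\in\mathcal X^n$ and $i,j\in\{1,\dots,n\}$: - (IF) $X_i\ge X_j$ implies $H_i(\boldsymbol X|\mathcal G)\ge H_j(\boldsymbol X|\mathcal G)$; - (AA) $H_i(X_{\pi(1)},\dots,X_{\pi(n)}|\mathcal G)=H_{\pi(i)}(\boldsymbol X|\mathcal G)$ for every permutation $\pi$ of $\{1,\dots,n\}$; - (OA) $H_k(\boldsymbol X-X_j\boldsymbol e^{(j)}+X_j\boldsymbol e^{(i)}|\mathcal G)=H_k(\boldsymbol X|\mathcal G)$ for all $k\notin\{i,j\}$; - (FP*) if $X_j=0$, then $\mathcal C^{\boldsymbol Y,\mathcal G}_{i,j}(H)=\mathcal C^{\boldsymbol X,\mathcal G}_{i,j}(H)$ for all $Z\in\mathcal X$, where $\boldsymbol Y=\boldsymbol X+Z\boldsymbol e^{(j)}-Z\boldsymbol e^{(i)}$;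 - (SI) if $X_j=0$ and $\alpha\in[0,1]$, then $H_j(\boldsymbol X+\alpha X_i\boldsymbol e^{(j)}-\alpha X_i\boldsymbol e^{(i)}|\mathcal G)=\alpha H_i(\boldsymbol X|\mathcal G)$; - (ZP) $X_i=0$ implies $H_i(\boldsymbol X|\mathcal G)=0$; - (IA) $\sigma\{H_i(\boldsymbol X|\mathcal G)\}\subseteq\mathcal G^{\boldsymbol X}$; - (IB) $\sigma\{X_i\}\subseteq\mathcal G^{\boldsymbol X}$ implies $H_i(\boldsymbol X|\mathcal G)=X_i$; - (CA) if $i\ne j$, $X_m\downarrow X$ and $|X_m|\le Y$ for all $m\in\mathbb N$, where $X_m,X,Y\in\mathcal X$, then $H_i(X_m\boldsymbol e^{(i)}+(S-X_m)\boldsymbol e^{(j)}|\mathcal G)\downarrow H_i(X\boldsymbol e^{(i)}+(S-X)\boldsymbol e^{(j)}|\mathcal G)$ for all $S\in\mathcal X$. (ii) $H$ is a conditional mean allocation mechanism: for all $S\in\mathcal X$ and $\mathcal G\in\Sigma$ there is a probability measure $Q=Q_{S,\mathcal G}$ on $(\Omega,\mathcal F)$ with $Q\ll\mathbb P$ and $Q=\mathbb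 P$ on $\mathcal G^{S}$, such that for all $\boldsymbol X\in\mathcal X^n$ with $S^{\boldsymbol X}=S$ and all $i\in\{1,\dots,n\}$, $X_i$ is $Q$-integrable and $$H_i(\boldsymbol X|\mathcal G)=\mathbb E^{Q}\left[X_i\,\middle|\,\mathcal G^{S}\right]\qquad\mathbb P\text{-a.s.}$$ -/

import Mathlib

open MeasureTheory Filter

noncomputable section

namespace AllocationMechanism

/-- `Σ`: the set of all sub-sigma-algebras of the ambient sigma-algebra `m0` of `Ω`. -/
abbrev SubSigma (Ω : Type*) [m0 : MeasurableSpace Ω] : Type _ :=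
  {m : MeasurableSpace Ω // m ≤ m0}

/-- `𝒳 = L¹(Ω, F, P)`: integrable random variables modulo almost sure equality, with the
almost sure order. -/
abbrev Endowment {Ω : Type*} [MeasurableSpace Ω] (P : Measure Ω) : Type _ := Lp ℝ 1 P

/-- Maps `𝒳ⁿ × Σ → 𝒳ⁿ`; `H X G i` is `H_i(X | G)`. -/
abbrev Mechanism {Ω : Type*} [MeasurableSpace Ω] (P : Measure Ω) (n : ℕ) : Type _ :=
  (Fin n → Endowment P) → SubSigma Ω → Fin n → Endowment P

variable {Ω : Type*} [m0 : MeasurableSpace Ω] {P : Measure Ω} {n : ℕ}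

/-- The aggregate endowment `S^X = ∑ i, X_i`. -/
def aggregate (X : Fin n → Endowment P) : Endowment P := ∑ i, X i

/-- `G^S = σ{G, σ{S}}`. As `S` is a class modulo almost sure equality, `σ{S}` is generated by a
(measurable) representative. Another representative changes `G^S` by `P`-null sets only, and every
notion below that uses `G^S` is insensitive to such a change. -/
def augment (G : SubSigma Ω) (S : Endowment P) : SubSigma Ω :=
  ⟨G.1 ⊔ MeasurableSpace.comap (S : Ω → ℝ) inferInstance,
    sup_le G.2 (Lp.stronglyMeasurable S).measurable.comap_le⟩

/-- `σ{X} ⊆ G` for a class `X` modulo almost sure equality: some representative of `X` is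
`G`-measurable. -/
def GeneratedIn (X : Endowment P) (G : SubSigma Ω) : Prop :=
  AEStronglyMeasurable[G.1] (X : Ω → ℝ) P

/-- `X_m ↓ X`: the sequence is decreasing and its infimum in `𝒳` is `X`. -/
def DecreasesTo (Xs : ℕ → Endowment P) (X : Endowment P) : Prop :=
  Antitone Xs ∧ IsGLB (Set.range Xs) X

/-- The local frictional cost `X_i + X_j - H_i(X | G) - H_j(X | G)`. -/
def localCost (H : Mechanism P n) (X : Fin n → Endowment P) (G : SubSigma Ω) (i j : Fin n) :
    Endowment P :=
  X i + X j - H X G i - H X G j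

/-- `H ∈ 𝒜ℳ`: the values of `H` are sub-allocations of the aggregate endowment. -/
def IsAllocationMechanism (H : Mechanism P n) : Prop :=
  ∀ (X : Fin n → Endowment P) (G : SubSigma Ω), ∑ i, H X G i ≤ aggregate X

/-- IF. -/
def InternalFairness (H : Mechanism P n) : Prop :=
  ∀ (G : SubSigma Ω) (X : Fin n → Endowment P) (i j : Fin n), X j ≤ X i → H X G j ≤ H X G i

/-- AA. -/
def AgentAnonymity (H : Mechanism P n) : Prop :=
  ∀ (π : Equiv.Perm (Fin n)) (G : SubSigma Ω) (X : Fin n → Endowment P) (i : Fin n),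
    H (fun k => X (π k)) G i = H X G (π i)

/-- OA. -/
def OperationalAnonymity (H : Mechanism P n) : Prop :=
  ∀ (G : SubSigma Ω) (X : Fin n → Endowment P) (i j k : Fin n), k ≠ i → k ≠ j →
    H (X - Pi.single j (X j) + Pi.single i (X j)) G k = H X G k

/-- FP*. -/
def FrictionlessParticipation (H : Mechanism P n) : Prop :=
  ∀ (G : SubSigma Ω) (X : Fin n → Endowment P) (j : Fin n), X j = 0 →
    ∀ (i : Fin n) (Z : Endowment P),
      localCost H (X + Pi.single j Z - Pi.single i Z) G i j = localCost H X G i j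

/-- SI. -/
def ScaleInvariance (H : Mechanism P n) : Prop :=
  ∀ (G : SubSigma Ω) (i : Fin n) (α : ℝ), α ∈ Set.Icc (0 : ℝ) 1 →
    ∀ (X : Fin n → Endowment P) (j : Fin n), X j = 0 →
      H (X + Pi.single j (α • X i) - Pi.single i (α • X i)) G j = α • H X G i

/-- ZP. -/
def ZeroPreserving (H : Mechanism P n) : Prop :=
  ∀ (G : SubSigma Ω) (X : Fin n → Endowment P) (i : Fin n), X i = 0 → H X G i = 0

/-- IA. -/
def InformationAnonymity (H : Mechanism P n) : Prop :=
  ∀ (G : SubSigma Ω) (X : Fin n → Endowment P) (i : Fin n),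
    GeneratedIn (H X G i) (augment G (aggregate X))

/-- IB. -/
def InformationBacktracking (H : Mechanism P n) : Prop :=
  ∀ (G : SubSigma Ω) (i : Fin n) (X : Fin n → Endowment P),
    GeneratedIn (X i) (augment G (aggregate X)) → H X G i = X i

/-- CA. -/
def ContinuityFromAbove (H : Mechanism P n) : Prop :=
  ∀ (Xs : ℕ → Endowment P) (X Y : Endowment P), DecreasesTo Xs X → (∀ m, |Xs m| ≤ Y) →
    ∀ (S : Endowment P) (G : SubSigma Ω) (i j : Fin n), i ≠ j →
      DecreasesTo (fun m => H (Pi.single i (Xs m) + Pi.single j (S - Xs m)) G i)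
        (H (Pi.single i X + Pi.single j (S - X)) G i)

/-- The Allocation Properties: ZP, IA, IB and CA. -/
def AllocationProperties (H : Mechanism P n) : Prop :=
  ZeroPreserving H ∧ InformationAnonymity H ∧ InformationBacktracking H ∧ ContinuityFromAbove H

/-- `△^P(F | G)`: the probability measures `Q ≪ P` on the ambient sigma-algebra that agree
with `P` on `G`. -/
def compatibleMeasures (P : Measure Ω) (G : SubSigma Ω) : Set (Measure Ω) :=
  {Q | IsProbabilityMeasure Q ∧ Q ≪ P ∧ Q.trim G.2 = P.trim G.2}

/-- `H` is the conditional mean allocation mechanism of the family `Q` of probability measures,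
indexed by the aggregate endowment and the information set: `X_i` is integrable for the measure
`Q` at `(S^X, G)`, and `H_i(X | G)` is its conditional expectation given `G^X` under that measure. -/
def IsConditionalMeanMechanism (H : Mechanism P n)
    (Q : Endowment P → SubSigma Ω → Measure Ω) : Prop :=
  (∀ S G, IsProbabilityMeasure (Q S G)) ∧
  ∀ (X : Fin n → Endowment P) (G : SubSigma Ω) (i : Fin n),
    Integrable (X i : Ω → ℝ) (Q (aggregate X) G) ∧
    (H X G i : Ω → ℝ) =ᵐ[P]
      condExp (augment G (aggregate X)).1 (Q (aggregate X) G) (X i : Ω → ℝ)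

end AllocationMechanism

end

/-!
Both sides of the equivalence say that `H_i(X | G) = h (X_i)`, where `h` depends on `S = S^X` and
`G` only and is a positive linear operator on `L¹(P)` that takes `G^S`-measurable values and fixes
the `G^S`-measurable elements (`IsCondExpOperator`).

The axioms yield such an operator (`exists_condExpOperator`). Operational anonymity merges the
endowments of all agents but one into a single counterparty, and agent anonymity removes the
dependence on the agent's index, so that the allocation to an agent depends on their own endowment,
`S` and `G` only. Frictionless participation together with zero preservation is additivity, because
a third agent can hold whatever is needed to keep the aggregate equal to `S`; scale invariance gives
homogeneity, internal fairness positivity, and the two information axioms the range and the fixed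
points. Conversely an operator of this kind satisfies all axioms (`axioms_of_condExpOperator`).

The continuity of `h` is automatic: positive linear maps on Banach lattices are bounded
(`LinearMap.exists_norm_le_mul_of_nonneg`). As decreasing order convergence in `L¹` is norm
convergence (`DecreasesTo.tendsto`), `h` is then continuous from above.

An operator `h` is a conditional expectation (`IsCondExpOperator.exists_measure`): the positive
continuous functional `X ↦ ∫ h X ∂P` is integration with respect to a measure `Q`, which agrees with
`P` on `G^S` because `h` fixes indicators of events of `G^S`. Positivity and these fixed points
force `h (1_s X) = 1_s (h X)` for `s` in `G^S`, hence `∫_s h X ∂P = ∫_s X ∂Q`, which characterizes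
`E^Q[X | G^S]`. In the other direction (`exists_condExpOperator_of_condExp`), every `Y` in `L¹` is
an endowment in some allocation of `S`, hence `Q`-integrable, and relations between `G^S`-measurable
functions transfer from `Q` to `P` because the two measures agree on `G^S`.
-/

noncomputable section

/-! ### Positive operators and order convergence in `L¹` -/

/-- Positive linear maps on a Banach lattice are bounded: otherwise there would be positive
vectors `z k` of norm `2⁻ᵏ` with `‖f (z k)‖ > 2ᵏ`, although `f (z k) ≤ f (∑ k, z k)`. -/
theorem LinearMap.exists_norm_le_mul_of_nonneg {E F : Type*}
    [NormedAddCommGroup E] [Lattice E] [HasSolidNorm E] [IsOrderedAddMonoid E] [NormedSpace ℝ E]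
    [PosSMulMono ℝ E] [CompleteSpace E]
    [NormedAddCommGroup F] [Lattice F] [HasSolidNorm F] [IsOrderedAddMonoid F] [NormedSpace ℝ F]
    (f : E →ₗ[ℝ] F) (hf : ∀ x, 0 ≤ x → 0 ≤ f x) : ∃ C, ∀ x, ‖f x‖ ≤ C * ‖x‖ := by
  have hmono : ∀ {x y}, x ≤ y → f x ≤ f y := fun {x y} hxy => by
    have := hf (y - x) (sub_nonneg.2 hxy)
    rwa [map_sub, sub_nonneg] at this
  by_contra! hC
  choose x hx using fun k : ℕ => hC (4 ^ k)
  have hfy : ∀ k, ‖f (x k)‖ ≤ ‖f |x k|‖ := fun k => by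
    refine norm_le_norm_of_abs_le_abs ?_
    rw [abs_of_nonneg (hf _ (abs_nonneg _))]
    exact abs_le'.2 ⟨hmono (le_abs_self _), by rw [← map_neg]; exact hmono (neg_le_abs _)⟩
  have hpos : ∀ k, 0 < ‖x k‖ := fun k => by
    refine norm_pos_iff.2 fun h0 => ?_
    have := hx k
    simp [h0] at this
  let z : ℕ → E := fun k => ((2 : ℝ) ^ k * ‖x k‖)⁻¹ • |x k|
  have hz0 : ∀ k, 0 ≤ z k := fun k => smul_nonneg (by positivity) (abs_nonneg _)
  have hzn : ∀ k, ‖z k‖ = (1 / 2 : ℝ) ^ k := fun k => by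
    have := (hpos k).ne'
    rw [norm_smul, norm_abs_eq_norm, Real.norm_of_nonneg (by positivity)]
    field_simp
    rw [← mul_pow]; norm_num
  have hz : Summable z := Summable.of_norm (by simpa only [hzn] using summable_geometric_two)
  have hle : ∀ k, ‖f (z k)‖ ≤ ‖f (∑' k, z k)‖ := fun k => by
    have h1 := hmono (hz.le_tsum k fun j _ => hz0 j)
    have h0 := hf _ (hz0 k)
    refine norm_le_norm_of_abs_le_abs ?_
    rwa [abs_of_nonneg h0, abs_of_nonneg (h0.trans h1)]
  have hlt : ∀ k, (2 : ℝ) ^ k < ‖f (z k)‖ := fun k => by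
    have h1 := (hx k).trans_le (hfy k)
    have h2 := hpos k
    rw [map_smul, norm_smul, Real.norm_of_nonneg (by positivity), inv_mul_eq_div,
      lt_div_iff₀ (by positivity), ← mul_assoc, ← mul_pow]
    norm_num
    exact h1
  obtain ⟨k, hk⟩ := pow_unbounded_of_one_lt ‖f (∑' k, z k)‖ (one_lt_two : (1 : ℝ) < 2)
  exact absurd (hk.trans (hlt k)) (hle k).not_gt

namespace AllocationMechanism

variable {Ω : Type*} [m0 : MeasurableSpace Ω] {P : Measure Ω} {n : ℕ}

instance : PosSMulMono ℝ (Endowment P) where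
  smul_le_smul_of_nonneg_left c hc X Y hXY := by
    rw [← Lp.coeFn_le] at hXY ⊢
    filter_upwards [Lp.coeFn_smul c X, Lp.coeFn_smul c Y, hXY] with ω h1 h2 h3
    simpa only [h1, h2, Pi.smul_apply] using smul_le_smul_of_nonneg_left h3 hc

theorem norm_sub_eq_integral_sub {X Y : Endowment P} (h : X ≤ Y) :
    ‖Y - X‖ = ∫ ω, Y ω ∂P - ∫ ω, X ω ∂P := by
  rw [L1.norm_eq_integral_norm, ← integral_sub (L1.integrable_coeFn Y) (L1.integrable_coeFn X)]
  rw [← Lp.coeFn_le] at h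
  refine integral_congr_ae ?_
  filter_upwards [h, Lp.coeFn_sub Y X] with ω h1 h2
  rw [h2, Pi.sub_apply, Real.norm_of_nonneg (sub_nonneg.2 h1)]

/-- The norm of `L¹` is additive on the positive cone, so a decreasing sequence that is bounded
below is Cauchy. -/
theorem DecreasesTo.tendsto {Xs : ℕ → Endowment P} {X : Endowment P} (h : DecreasesTo Xs X) :
    Tendsto Xs atTop (nhds X) := by
  obtain ⟨hanti, hglb⟩ := h
  let I : ℕ → ℝ := fun m => ∫ ω, Xs m ω ∂P
  have hI : ∀ {k m}, k ≤ m → ‖Xs k - Xs m‖ = I k - I m := fun hkm =>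
    norm_sub_eq_integral_sub (hanti hkm)
  have hIanti : Antitone I := fun k m hkm => by
    have := norm_nonneg (Xs k - Xs m)
    rw [hI hkm] at this
    linarith
  have hbdd : BddBelow (Set.range I) := by
    refine ⟨∫ ω, X ω ∂P, ?_⟩
    rintro _ ⟨m, rfl⟩
    have := norm_sub_eq_integral_sub (hglb.1 ⟨m, rfl⟩)
    have h0 := norm_nonneg (Xs m - X)
    simp only [I]
    linarith
  have hdist : ∀ {k m}, k ≤ m → dist (Xs k) (Xs m) ≤ I k - ⨅ m, I m := fun {k m} hkm => by
    rw [dist_eq_norm, hI hkm]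
    have := ciInf_le hbdd m
    linarith
  have hcauchy : CauchySeq Xs := by
    refine cauchySeq_of_le_tendsto_0 (fun N => 2 * (I N - ⨅ m, I m)) (fun k m N hk hm => ?_) ?_
    · have h1 := hdist hk
      have h2 := hdist hm
      rw [dist_comm] at h1
      linarith [dist_triangle (Xs k) (Xs N) (Xs m)]
    · have := ((tendsto_atTop_ciInf hIanti hbdd).sub_const (⨅ m, I m)).const_mul 2
      simpa using this
  obtain ⟨Y, hY⟩ := cauchySeq_tendsto_of_complete hcauchy
  rwa [hglb.unique (isGLB_of_tendsto_atTop hanti hY)]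

/-! ### Abstract conditional expectation operators -/

/-- The order-theoretic description of a conditional expectation given `G`: a positive linear
operator on `L¹` that takes `G`-measurable values and fixes the `G`-measurable elements. -/
structure IsCondExpOperator (G : SubSigma Ω) (h : Endowment P →ₗ[ℝ] Endowment P) : Prop where
  nonneg : ∀ X, 0 ≤ X → 0 ≤ h X
  generatedIn : ∀ X, GeneratedIn (h X) G
  eq_self : ∀ X, GeneratedIn X G → h X = X

namespace IsCondExpOperator

variable {G : SubSigma Ω} {h : Endowment P →ₗ[ℝ] Endowment P}

theorem mono (hh : IsCondExpOperator G h) {X Y : Endowment P} (hXY : X ≤ Y) : h X ≤ h Y := by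
  have := hh.nonneg (Y - X) (sub_nonneg.2 hXY)
  rwa [map_sub, sub_nonneg] at this

theorem continuous (hh : IsCondExpOperator G h) : Continuous h := by
  obtain ⟨C, hC⟩ := h.exists_norm_le_mul_of_nonneg hh.nonneg
  exact AddMonoidHomClass.continuous_of_bound h C hC

theorem decreasesTo (hh : IsCondExpOperator G h) {Xs : ℕ → Endowment P} {X : Endowment P}
    (hX : DecreasesTo Xs X) : DecreasesTo (fun m => h (Xs m)) (h X) := by
  have hanti : Antitone fun m => h (Xs m) := fun _ _ hkm => hh.mono (hX.1 hkm)
  exact ⟨hanti, isGLB_of_tendsto_atTop hanti ((hh.continuous.tendsto X).comp hX.tendsto)⟩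

end IsCondExpOperator

/-! ### Mechanisms satisfying the axioms are families of conditional expectation operators -/

theorem generatedIn_augment_self (G : SubSigma Ω) (S : Endowment P) :
    GeneratedIn S (augment G S) := by
  have : Measurable[(augment G S).1] (S : Ω → ℝ) :=
    (comap_measurable (S : Ω → ℝ)).mono le_sup_right le_rfl
  exact this.stronglyMeasurable.aestronglyMeasurable

theorem aggregate_add (X Y : Fin n → Endowment P) :
    aggregate (X + Y) = aggregate X + aggregate Y := by
  simp [aggregate, Finset.sum_add_distrib]

theorem aggregate_sub (X Y : Fin n → Endowment P) :
    aggregate (X - Y) = aggregate X - aggregate Y := by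
  simp [aggregate, Finset.sum_sub_distrib]

theorem aggregate_single (i : Fin n) (Z : Endowment P) :
    aggregate (Pi.single i Z) = Z := by
  simp [aggregate]

theorem aggregate_comp_perm (π : Equiv.Perm (Fin n)) (X : Fin n → Endowment P) :
    aggregate (fun k => X (π k)) = aggregate X :=
  Equiv.sum_comp π X

/-- By operational anonymity, the endowments of all agents other than `k` may be merged into the
endowment of a single agent `j` without changing the allocation to `k`. -/
theorem OperationalAnonymity.merge {H : Mechanism P n} (hOA : OperationalAnonymity H)
    (G : SubSigma Ω) {k j : Fin n} (hkj : k ≠ j) (X : Fin n → Endowment P) :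
    H X G k = H (Pi.single k (X k) + Pi.single j (aggregate X - X k)) G k := by
  -- The agents outside `s ∪ {j, k}` have already been merged into `j`.
  suffices key : ∀ (s : Finset (Fin n)) (X : Fin n → Endowment P),
      (∀ l, l ∉ s → l ≠ k → l ≠ j → X l = 0) →
        H X G k = H (Pi.single k (X k) + Pi.single j (aggregate X - X k)) G k from
    key Finset.univ X fun l hl => absurd (Finset.mem_univ l) hl
  intro s
  induction s using Finset.induction_on with
  | empty =>
    intro X hX
    have hsum : aggregate X = X k + X j := by
      rw [aggregate, ← Finset.sum_pair hkj]
      refine (Finset.sum_subset (Finset.subset_univ _) fun l _ hl => ?_).symm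
      simp only [Finset.mem_insert, Finset.mem_singleton, not_or] at hl
      exact hX l (Finset.notMem_empty l) hl.1 hl.2
    congr 1
    rw [hsum, add_sub_cancel_left]
    funext l
    by_cases hlk : l = k
    · subst hlk; simp [hkj]
    by_cases hlj : l = j
    · subst hlj; simp [hlk]
    simp [hlk, hlj, hX l (Finset.notMem_empty l) hlk hlj]
  | insert a s _ ih =>
    intro X hX
    by_cases ha : a = k ∨ a = j
    · refine ih X fun l hl hlk hlj => hX l ?_ hlk hlj
      rw [Finset.mem_insert, not_or]
      refine ⟨?_, hl⟩
      rintro rfl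
      exact ha.elim hlk hlj
    · rw [not_or] at ha
      obtain ⟨hak, haj⟩ := ha
      have hXk : (X - Pi.single a (X a) + Pi.single j (X a) : Fin n → Endowment P) k = X k := by
        simp [hkj, Ne.symm hak]
      have hagg : aggregate (X - Pi.single a (X a) + Pi.single j (X a)) = aggregate X := by
        rw [aggregate_add, aggregate_sub, aggregate_single, aggregate_single, sub_add_cancel]
      rw [← hOA G X j a k hkj (Ne.symm hak), ih _ fun l hl hlk hlj => ?_, hXk, hagg]
      by_cases hla : l = a
      · subst hla; simp [hlj]
      · simp [hla, hlj, hX l (by simp [hla, hl]) hlk hlj]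

/-- The axioms make `H_i(X | G)` the image of `X_i` under a conditional expectation operator that
depends on `S^X` and `G` only. It is additive by frictionless participation, which needs a third
agent to hold the rest of `S`, and it is then real-homogeneous by scale invariance. -/
theorem exists_condExpOperator (hn : 3 ≤ n) {H : Mechanism P n} (hIF : InternalFairness H)
    (hAA : AgentAnonymity H) (hOA : OperationalAnonymity H) (hFP : FrictionlessParticipation H)
    (hSI : ScaleInvariance H) (hZP : ZeroPreserving H) (hIA : InformationAnonymity H)
    (hIB : InformationBacktracking H) (S : Endowment P) (G : SubSigma Ω) :
    ∃ h : Endowment P →ₗ[ℝ] Endowment P, IsCondExpOperator (augment G S) h ∧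
      ∀ X, aggregate X = S → ∀ i, H X G i = h (X i) := by
  let a : Fin n := ⟨0, by omega⟩
  let b : Fin n := ⟨1, by omega⟩
  let c : Fin n := ⟨2, by omega⟩
  have hab : a ≠ b := by simp [a, b]
  have hac : a ≠ c := by simp [a, c]
  have hbc : b ≠ c := by simp [b, c]
  let h : Endowment P → Endowment P := fun Y => H (Pi.single a Y + Pi.single b (S - Y)) G a
  have hH : ∀ X, aggregate X = S → ∀ i, H X G i = h (X i) := by
    intro X hX i
    have h1 := hAA (Equiv.swap a i) G X a
    rw [Equiv.swap_apply_left] at h1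
    rw [← h1, hOA.merge G hab, aggregate_comp_perm, hX, Equiv.swap_apply_left]
  -- The three-agent allocation `(A, B, S - A - B)` of `S`.
  let T : Endowment P → Endowment P → Fin n → Endowment P := fun A B =>
    Pi.single a A + Pi.single b B + Pi.single c (S - A - B)
  have hTS : ∀ A B, aggregate (T A B) = S := fun A B => by
    simp only [T, aggregate_add, aggregate_single]; abel
  have hTa : ∀ A B, T A B a = A := fun A B => by simp [T, hab, hac]
  have hTb : ∀ A B, T A B b = B := fun A B => by simp [T, hab.symm, hbc]
  have hHa : ∀ A B, H (T A B) G a = h A := fun A B => by rw [hH _ (hTS A B), hTa]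
  have hHb : ∀ A B, H (T A B) G b = h B := fun A B => by rw [hH _ (hTS A B), hTb]
  have hTmove : ∀ A Z, T A 0 + Pi.single b Z - Pi.single a Z = T (A - Z) Z := fun A Z => by
    simp only [T, Pi.single_sub, Pi.single_zero]; abel
  have hzero : h 0 = 0 := by
    rw [← hHb 0 0]; exact hZP G _ b (hTb 0 0)
  have hadd : ∀ A B, h (A + B) = h A + h B := fun A B => by
    have := hFP G (T (A + B) 0) b (hTb _ _) a B
    rw [hTmove] at this
    simp only [localCost, hHa, hHb, hTa, hTb, add_sub_cancel_right, hzero, add_zero,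
      sub_zero, sub_sub, sub_right_inj] at this
    exact this.symm
  have hscale : ∀ α : ℝ, 0 ≤ α → α ≤ 1 → ∀ A, h (α • A) = α • h A := fun α h0 h1 A => by
    have := hSI G a α ⟨h0, h1⟩ (T A 0) b (hTb _ _)
    rwa [hTa, hTmove, hHa, hHb] at this
  have hpos : ∀ α : ℝ, 0 ≤ α → ∀ A, h (α • A) = α • h A := fun α h0 A => by
    rcases le_total α 1 with h1 | h1
    · exact hscale α h0 h1 A
    · have hα : α ≠ 0 := by linarith
      have := hscale α⁻¹ (inv_nonneg.2 h0) (inv_le_one_of_one_le₀ h1) (α • A)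
      rw [inv_smul_smul₀ hα] at this
      rw [this, smul_inv_smul₀ hα]
  have hneg : ∀ A, h (-A) = -h A := fun A => by
    rw [eq_neg_iff_add_eq_zero, ← hadd, neg_add_cancel, hzero]
  let L : Endowment P →ₗ[ℝ] Endowment P :=
    { toFun := h
      map_add' := hadd
      map_smul' := fun α A => by
        rcases le_total 0 α with h0 | h0
        · exact hpos α h0 A
        · have := hpos (-α) (neg_nonneg.2 h0) A
          rw [neg_smul, neg_smul, hneg, neg_inj] at this
          exact this }
  refine ⟨L, ⟨fun X hX => ?_, fun X => ?_, fun X hX => ?_⟩, hH⟩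
  · change 0 ≤ h X
    have := hIF G (T X 0) a b (by rwa [hTa, hTb])
    rwa [hHa, hHb, hzero] at this
  · have := hIA G (T X 0) a
    rwa [hHa, hTS] at this
  · have := hIB G a (T X 0) (by rwa [hTa, hTS])
    rwa [hHa, hTa] at this

/-- Mechanisms given by conditional expectation operators satisfy all the axioms. -/
theorem axioms_of_condExpOperator {H : Mechanism P n}
    {h : Endowment P → SubSigma Ω → Endowment P →ₗ[ℝ] Endowment P}
    (hh : ∀ S G, IsCondExpOperator (augment G S) (h S G))
    (hH : ∀ X G i, H X G i = h (aggregate X) G (X i)) :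
    IsAllocationMechanism H ∧ InternalFairness H ∧ AgentAnonymity H ∧ OperationalAnonymity H ∧
      FrictionlessParticipation H ∧ ScaleInvariance H ∧ AllocationProperties H := by
  have hmove : ∀ (X : Fin n → Endowment P) (i j : Fin n) (Z : Endowment P),
      aggregate (X + Pi.single j Z - Pi.single i Z) = aggregate X := fun X i j Z => by
    rw [aggregate_sub, aggregate_add, aggregate_single, aggregate_single, add_sub_cancel_right]
  refine ⟨fun X G => ?_, fun G X i j hij => ?_, fun π G X i => ?_, fun G X i j k hki hkj => ?_,
    fun G X j hj i Z => ?_, fun G i α _ X j hj => ?_, fun G X i hi => ?_, fun G X i => ?_,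
    fun G i X hX => ?_, fun Xs X Y hX _ S G i j hij => ?_⟩
  · simp only [hH, ← map_sum]
    exact ((hh _ G).eq_self _ (generatedIn_augment_self G _)).le
  · rw [hH, hH]
    exact (hh _ G).mono hij
  · rw [hH, hH, aggregate_comp_perm]
  · rw [hH, hH, aggregate_add, aggregate_sub, aggregate_single, aggregate_single, sub_add_cancel]
    simp [hki, hkj]
  · by_cases hij : i = j
    · subst hij; simp
    · simp only [localCost, hH, hmove]
      simp [hij, Ne.symm hij, hj]
      abel
  · rw [hH, hH, hmove]
    by_cases hij : i = j
    · subst hij; simp [hj]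
    · simp [Ne.symm hij, hj]
  · rw [hH, hi, map_zero]
  · rw [hH]
    exact (hh _ G).generatedIn _
  · rw [hH]
    exact (hh _ G).eq_self _ hX
  · have key : ∀ Z : Endowment P,
        H (Pi.single i Z + Pi.single j (S - Z)) G i = h S G Z := fun Z => by
      rw [hH, aggregate_add, aggregate_single, aggregate_single, add_sub_cancel]
      simp [hij]
    simp only [key]
    exact (hh S G).decreasesTo hX

/-! ### Conditional expectations under compatible measures -/

theorem ae_eq_of_ae_eq_of_mem_compatibleMeasures {G : SubSigma Ω} {Q : Measure Ω}
    (hQ : Q ∈ compatibleMeasures P G) {f g : Ω → ℝ} (hf : StronglyMeasurable[G.1] f)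
    (hg : StronglyMeasurable[G.1] g) (h : f =ᵐ[Q] g) : f =ᵐ[P] g := by
  rw [← hf.ae_eq_trim_iff G.2 hg] at h ⊢
  rwa [← hQ.2.2]

theorem ae_le_of_ae_le_of_mem_compatibleMeasures {G : SubSigma Ω} {Q : Measure Ω}
    (hQ : Q ∈ compatibleMeasures P G) {f g : Ω → ℝ} (hf : StronglyMeasurable[G.1] f)
    (hg : StronglyMeasurable[G.1] g) (h : f ≤ᵐ[Q] g) : f ≤ᵐ[P] g := by
  rw [← hf.ae_le_trim_iff G.2 hg] at h ⊢
  rwa [← hQ.2.2]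

/-- Conditional expectations under a compatible measure that integrates all of `L¹(P)` form a
conditional expectation operator on `L¹(P)`: identities between `G`-measurable functions carry over
from `Q` to `P`. -/
theorem exists_condExpOperator_of_condExp {G : SubSigma Ω} {Q : Measure Ω}
    (hQ : Q ∈ compatibleMeasures P G) {k : Endowment P → Endowment P}
    (hint : ∀ X : Endowment P, Integrable (X : Ω → ℝ) Q)
    (hk : ∀ X, (k X : Ω → ℝ) =ᵐ[P] condExp G.1 Q (X : Ω → ℝ)) :
    ∃ h : Endowment P →ₗ[ℝ] Endowment P, IsCondExpOperator G h ∧ ∀ X, h X = k X := by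
  have hprob : IsProbabilityMeasure Q := hQ.1
  have hac : Q ≪ P := hQ.2.1
  have hm : ∀ f : Ω → ℝ, StronglyMeasurable[G.1] (condExp G.1 Q f) := fun f =>
    stronglyMeasurable_condExp
  let h : Endowment P →ₗ[ℝ] Endowment P :=
    { toFun := k
      map_add' := fun X Y => by
        have h1 : condExp G.1 Q (X + Y : Endowment P) =ᵐ[P]
            condExp G.1 Q X + condExp G.1 Q Y :=
          ae_eq_of_ae_eq_of_mem_compatibleMeasures hQ (hm _) ((hm _).add (hm _))
            ((condExp_congr_ae (hac.ae_le (Lp.coeFn_add X Y))).trans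
              (condExp_add (hint X) (hint Y) G.1))
        refine Lp.ext (((hk _).trans h1).trans ?_)
        exact ((hk X).add (hk Y)).symm.trans (Lp.coeFn_add _ _).symm
      map_smul' := fun c X => by
        have h1 : condExp G.1 Q (c • X : Endowment P) =ᵐ[P] c • condExp G.1 Q X :=
          ae_eq_of_ae_eq_of_mem_compatibleMeasures hQ (hm _) ((hm _).const_smul c)
            ((condExp_congr_ae (hac.ae_le (Lp.coeFn_smul c X))).trans
              (condExp_smul c _ G.1))
        refine Lp.ext (((hk _).trans h1).trans ?_)
        exact ((hk X).const_smul c).symm.trans (Lp.coeFn_smul _ _).symm }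
  refine ⟨h, ⟨fun X hX => ?_, fun X => ⟨_, hm _, hk X⟩, fun X hX => ?_⟩, fun X => rfl⟩
  · rw [← Lp.coeFn_nonneg] at hX ⊢
    refine EventuallyLE.trans_eq ?_ (hk X).symm
    exact ae_le_of_ae_le_of_mem_compatibleMeasures hQ stronglyMeasurable_zero (hm _)
      (condExp_nonneg (hac.ae_le hX))
  · obtain ⟨g, hg, hXg⟩ := hX
    have h1 : (X : Ω → ℝ) =ᵐ[Q] g := hac.ae_le hXg
    have h2 : condExp G.1 Q X =ᵐ[P] g :=
      ae_eq_of_ae_eq_of_mem_compatibleMeasures hQ (hm _) hg ((condExp_congr_ae h1).trans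
        (condExp_of_stronglyMeasurable G.2 hg ((hint X).congr h1)).eventuallyEq)
    exact Lp.ext (((hk X).trans h2).trans hXg.symm)

/-! ### Measures from positive functionals -/

/-- Integration over `s` with respect to a measure dominated by a multiple of `P`, as a continuous
functional on `L¹(P)`. -/
theorem exists_setIntegralCLM {Q : Measure Ω} {C : ENNReal} (hC : C ≠ ⊤) (hQ : Q ≤ C • P)
    (s : Set Ω) : ∃ ψ : Endowment P →L[ℝ] ℝ, ∀ X : Endowment P, ψ X = ∫ ω in s, X ω ∂Q := by
  have hint : ∀ X : Endowment P, Integrable X Q := fun X =>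
    ((L1.integrable_coeFn X).smul_measure hC).mono_measure hQ
  have hac : Q ≪ P := Measure.absolutelyContinuous_of_le_smul hQ
  let ψ : Endowment P →ₗ[ℝ] ℝ :=
    { toFun := fun X => ∫ ω in s, X ω ∂Q
      map_add' := fun X Y => by
        rw [← integral_add (hint X).integrableOn (hint Y).integrableOn]
        exact integral_congr_ae (ae_restrict_of_ae (hac.ae_le (Lp.coeFn_add X Y)))
      map_smul' := fun c X => by
        rw [RingHom.id_apply, smul_eq_mul, ← integral_const_mul]
        exact integral_congr_ae (ae_restrict_of_ae (hac.ae_le (Lp.coeFn_smul c X))) }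
  have hψ : ∀ X, 0 ≤ X → 0 ≤ ψ X := fun X hX =>
    setIntegral_nonneg_of_ae (hac.ae_le ((Lp.coeFn_nonneg X).2 hX))
  obtain ⟨C, hC⟩ := ψ.exists_norm_le_mul_of_nonneg hψ
  exact ⟨ψ.mkContinuous C hC, fun X => rfl⟩

variable [IsProbabilityMeasure P]

/-- The indicator of the event `s` as an element of `L¹`. -/
def eventLp (P : Measure Ω) [IsProbabilityMeasure P] {s : Set Ω} (hs : MeasurableSet s) :
    Endowment P :=
  indicatorConstLp 1 hs (measure_ne_top P s) 1

theorem eventLp_le {s t : Set Ω} (hs : MeasurableSet s) (ht : MeasurableSet t) (hst : s ⊆ t) :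
    eventLp P hs ≤ eventLp P ht := by
  rw [← Lp.coeFn_le]
  filter_upwards [indicatorConstLp_coeFn (p := 1) (hs := hs) (hμs := measure_ne_top P s)
    (c := (1 : ℝ)), indicatorConstLp_coeFn (p := 1) (hs := ht) (hμs := measure_ne_top P t)
    (c := (1 : ℝ))] with ω h1 h2
  rw [eventLp, eventLp, h1, h2]
  exact Set.indicator_le_indicator_of_subset hst (fun _ => zero_le_one) ω

theorem eventLp_empty : eventLp P (MeasurableSet.empty : MeasurableSet (∅ : Set Ω)) = 0 :=
  indicatorConstLp_empty

theorem eventLp_nonneg {s : Set Ω} (hs : MeasurableSet s) : 0 ≤ eventLp P hs := by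
  rw [← eventLp_empty]
  exact eventLp_le _ hs (Set.empty_subset s)

theorem eventLp_union {s t : Set Ω} (hs : MeasurableSet s) (ht : MeasurableSet t)
    (hst : Disjoint s t) : eventLp P (hs.union ht) = eventLp P hs + eventLp P ht :=
  indicatorConstLp_disjoint_union hs ht (measure_ne_top P s) (measure_ne_top P t) hst 1

theorem norm_eventLp {s : Set Ω} (hs : MeasurableSet s) : ‖eventLp P hs‖ = P.real s := by
  simp [eventLp, norm_indicatorConstLp]

theorem smul_eventLp {s : Set Ω} (hs : MeasurableSet s) (c : ℝ) :
    c • eventLp P hs = indicatorConstLp 1 hs (measure_ne_top P s) c := by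
  rw [eventLp, indicatorConstLp, indicatorConstLp, ← MemLp.toLp_const_smul]
  congr 1
  ext ω
  by_cases h : ω ∈ s <;> simp [h]

theorem generatedIn_eventLp {G : SubSigma Ω} {s : Set Ω} (hs : MeasurableSet[G.1] s) :
    GeneratedIn (eventLp P (G.2 s hs)) G := by
  have h1 : StronglyMeasurable[G.1] (s.indicator fun _ : Ω => (1 : ℝ)) :=
    (@stronglyMeasurable_const _ _ G.1 _ 1).indicator hs
  exact ⟨_, h1, indicatorConstLp_coeFn⟩

theorem clm_eq_of_eventLp {f g : Endowment P →L[ℝ] ℝ}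
    (h : ∀ (s : Set Ω) (hs : MeasurableSet s), f (eventLp P hs) = g (eventLp P hs)) : f = g := by
  ext X
  refine Lp.induction ENNReal.one_ne_top (fun X : Endowment P => f X = g X) ?_ ?_ ?_ X
  · intro c s hs _
    rw [Lp.simpleFunc.coe_indicatorConst, ← smul_eventLp hs c, map_smul, map_smul, h]
  · intro u v hu hv _ h1 h2
    rw [map_add, map_add, h1, h2]
  · exact isClosed_eq f.continuous g.continuous

/-- A positive continuous functional `φ` on `L¹` induces the measure `s ↦ φ (1_s)`, which is
dominated by a multiple of `P`. -/
theorem exists_measure_of_nonneg (φ : Endowment P →L[ℝ] ℝ) (hφ : ∀ X, 0 ≤ X → 0 ≤ φ X) :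
    ∃ Q : Measure Ω, Q ≤ ENNReal.ofReal ‖φ‖ • P ∧
      ∀ (s : Set Ω) (hs : MeasurableSet s), Q s = ENNReal.ofReal (φ (eventLp P hs)) := by
  have hφs : ∀ {s : Set Ω} (hs : MeasurableSet s), 0 ≤ φ (eventLp P hs) := fun hs =>
    hφ _ (eventLp_nonneg hs)
  let Q : Measure Ω := Measure.ofMeasurable
    (fun s hs => ENNReal.ofReal (φ (eventLp P hs))) (by simp [eventLp_empty]) (by
      intro f hf hd
      -- Finite additivity, for the partial unions of the sequence.
      have hpart : ∀ k, φ (eventLp P (MeasurableSet.biUnion (Set.to_countable (Set.Iio k))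
          fun i _ => hf i)) = ∑ i ∈ Finset.range k, φ (eventLp P (hf i)) := by
        intro k
        induction k with
        | zero => simp [eventLp_empty]
        | succ k ih =>
          rw [Finset.sum_range_succ, ← ih, ← map_add, ← eventLp_union]
          · congr 2
            ext ω
            simp only [Set.mem_iUnion, Set.mem_Iio, Set.mem_union, exists_prop,
              Nat.lt_succ_iff_lt_or_eq, or_and_right, exists_or, exists_eq_left]
          · rw [Set.disjoint_iUnion₂_left]
            exact fun i hi => hd (ne_of_lt hi)
      have htend : Tendsto (fun k => eventLp P (MeasurableSet.biUnion
          (Set.to_countable (Set.Iio k)) fun i _ => hf i)) atTop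
          (nhds (eventLp P (MeasurableSet.iUnion hf))) := by
        refine tendsto_indicatorConstLp_set ENNReal.one_ne_top ?_
        have hsub : ∀ k, ⋃ i ∈ Set.Iio k, f i ⊆ ⋃ i, f i := fun k =>
          Set.iUnion₂_subset fun i _ => Set.subset_iUnion f i
        simp only [fun k => symmDiff_of_le (hsub k)]
        have hanti : Antitone fun k => (⋃ i, f i) \ ⋃ i ∈ Set.Iio k, f i := fun k l hkl =>
          Set.sdiff_subset_sdiff_right (Set.biUnion_subset_biUnion_left (Set.Iio_subset_Iio hkl))
        have hempty : ⋂ k, (⋃ i, f i) \ ⋃ i ∈ Set.Iio k, f i = ∅ := by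
          refine Set.eq_empty_of_forall_notMem fun ω hω => ?_
          rw [Set.mem_iInter] at hω
          obtain ⟨i, hi⟩ := Set.mem_iUnion.1 (hω 0).1
          exact (hω (i + 1)).2 (Set.mem_biUnion (Set.mem_Iio.2 i.lt_succ_self) hi)
        have hmeas : ∀ k, NullMeasurableSet ((⋃ i, f i) \ ⋃ i ∈ Set.Iio k, f i) P := fun k =>
          ((MeasurableSet.iUnion hf).diff (MeasurableSet.biUnion (Set.to_countable _)
            fun i _ => hf i)).nullMeasurableSet
        have := tendsto_measure_iInter_atTop hmeas hanti ⟨0, measure_ne_top P _⟩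
        rwa [hempty, measure_empty] at this
      have hsum : HasSum (fun i => φ (eventLp P (hf i)))
          (φ (eventLp P (MeasurableSet.iUnion hf))) := by
        rw [hasSum_iff_tendsto_nat_of_nonneg fun i => hφs (hf i)]
        simpa only [Function.comp_def, hpart] using (φ.continuous.tendsto _).comp htend
      rw [← hsum.tsum_eq, ENNReal.ofReal_tsum_of_nonneg (fun i => hφs (hf i)) hsum.summable])
  have hQ : ∀ (s : Set Ω) (hs : MeasurableSet s), Q s = ENNReal.ofReal (φ (eventLp P hs)) :=
    fun s hs => Measure.ofMeasurable_apply s hs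
  refine ⟨Q, Measure.le_iff.2 fun s hs => ?_, hQ⟩
  rw [hQ s hs, Measure.smul_apply, smul_eq_mul, ← ENNReal.ofReal_toReal (measure_ne_top P s),
    ← ENNReal.ofReal_mul (norm_nonneg _)]
  refine ENNReal.ofReal_le_ofReal ((Real.le_norm_self _).trans ?_)
  exact (φ.le_opNorm _).trans_eq (by rw [norm_eventLp]; rfl)

/-- The pull-out property for an event `s` of `G`, in integrated form and for events `t`: as
`0 ≤ h (1_{s ∩ t}) ≤ 1_s` and `0 ≤ h (1_{t \ s}) ≤ 1_{sᶜ}`, the restriction of `h (1_t)` to `s` is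
`h (1_{s ∩ t})`. -/
theorem IsCondExpOperator.setIntegral_eventLp {G : SubSigma Ω}
    {h : Endowment P →ₗ[ℝ] Endowment P} (hh : IsCondExpOperator G h) {s t : Set Ω}
    (hs : MeasurableSet[G.1] s) (ht : MeasurableSet t) :
    ∫ ω in s, h (eventLp P ht) ω ∂P = ∫ ω, h (eventLp P ((G.2 s hs).inter ht)) ω ∂P := by
  have hs0 : MeasurableSet s := G.2 s hs
  -- A positive element below an event of `G` is mapped below the same event.
  have hzero : ∀ {u v : Set Ω} (hu : MeasurableSet u) (hv : MeasurableSet[G.1] v), u ⊆ v →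
      ∀ᵐ ω ∂P, ω ∉ v → h (eventLp P hu) ω = 0 := fun {u v} hu hv huv => by
    have h1 := hh.mono (eventLp_le hu (G.2 v hv) huv)
    rw [hh.eq_self _ (generatedIn_eventLp hv), ← Lp.coeFn_le] at h1
    have h0 := hh.nonneg _ (eventLp_nonneg hu)
    rw [← Lp.coeFn_nonneg] at h0
    filter_upwards [h0, h1, indicatorConstLp_coeFn_notMem (p := 1) (hs := G.2 v hv)
      (hμs := measure_ne_top P v) (c := (1 : ℝ))] with ω h0 h1 h2 hω
    exact le_antisymm (h1.trans_eq (h2 hω)) h0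
  have hsplit : eventLp P ht = eventLp P (hs0.inter ht) + eventLp P (ht.diff hs0) := by
    rw [← eventLp_union _ _ (Set.disjoint_sdiff_right.mono_left Set.inter_subset_left)]
    congr 1
    rw [Set.inter_comm, Set.inter_union_sdiff]
  rw [← integral_indicator hs0]
  refine integral_congr_ae ?_
  rw [hsplit, map_add]
  filter_upwards [hzero (hs0.inter ht) hs Set.inter_subset_left,
    hzero (ht.diff hs0) hs.compl (fun _ hω => hω.2),
    Lp.coeFn_add (h (eventLp P (hs0.inter ht))) (h (eventLp P (ht.diff hs0)))] with ω h1 h2 h3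
  by_cases hω : ω ∈ s
  · rw [Set.indicator_of_mem hω, h3, Pi.add_apply, h2 (by simpa using hω), add_zero]
  · rw [Set.indicator_of_notMem hω, h1 hω]

/-! ### Conditional expectation operators are conditional expectations -/

/-- Every conditional expectation operator `h` is the conditional expectation under a compatible
measure, namely the measure `Q` with `∫ X ∂Q = ∫ h X ∂P`. -/
theorem IsCondExpOperator.exists_measure {G : SubSigma Ω} {h : Endowment P →ₗ[ℝ] Endowment P}
    (hh : IsCondExpOperator G h) :
    ∃ Q ∈ compatibleMeasures P G, ∀ X : Endowment P,
      Integrable (X : Ω → ℝ) Q ∧ (h X : Ω → ℝ) =ᵐ[P] condExp G.1 Q (X : Ω → ℝ) := by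
  let hc : Endowment P →L[ℝ] Endowment P := ⟨h, hh.continuous⟩
  have hPle : P ≤ (1 : ENNReal) • P := by rw [one_smul]
  -- `I` is the expectation under `P`.
  obtain ⟨I, hI⟩ := exists_setIntegralCLM ENNReal.one_ne_top hPle Set.univ
  simp only [setIntegral_univ] at hI
  have hφ : ∀ X, 0 ≤ X → 0 ≤ (I.comp hc) X := fun X hX => by
    rw [ContinuousLinearMap.comp_apply, hI]
    exact integral_nonneg_of_ae ((Lp.coeFn_nonneg _).2 (hh.nonneg X hX))
  obtain ⟨Q, hQle, hQ⟩ := exists_measure_of_nonneg (I.comp hc) hφ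
  have hQreal : ∀ {s : Set Ω} (hs : MeasurableSet s),
      Q.real s = ∫ ω, h (eventLp P hs) ω ∂P := fun {s} hs => by
    rw [measureReal_def, hQ s hs, ENNReal.toReal_ofReal (hφ _ (eventLp_nonneg hs)),
      ContinuousLinearMap.comp_apply, hI]
    rfl
  have hQG : ∀ s, MeasurableSet[G.1] s → Q s = P s := fun s hs => by
    have hs0 := G.2 s hs
    rw [hQ s hs0, ContinuousLinearMap.comp_apply, hI]
    change ENNReal.ofReal (∫ ω, h (eventLp P hs0) ω ∂P) = P s
    rw [hh.eq_self _ (generatedIn_eventLp hs), eventLp, integral_indicatorConstLp, smul_eq_mul,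
      mul_one, measureReal_def, ENNReal.ofReal_toReal (measure_ne_top P s)]
  have hprob : IsProbabilityMeasure Q := ⟨by
    rw [hQG _ (@MeasurableSet.univ _ G.1), measure_univ]⟩
  have hac : Q ≪ P := Measure.absolutelyContinuous_of_le_smul hQle
  have hcomp : Q ∈ compatibleMeasures P G := by
    refine ⟨hprob, hac, @Measure.ext _ G.1 _ _ fun s hs => ?_⟩
    rw [trim_measurableSet_eq G.2 hs, trim_measurableSet_eq G.2 hs, hQG s hs]
  have hint : ∀ X : Endowment P, Integrable X Q := fun X =>
    ((L1.integrable_coeFn X).smul_measure ENNReal.ofReal_ne_top).mono_measure hQle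
  have hset : ∀ s, MeasurableSet[G.1] s → ∀ X : Endowment P,
      ∫ ω in s, h X ω ∂P = ∫ ω in s, X ω ∂Q := fun s hs X => by
    obtain ⟨ψ, hψ⟩ := exists_setIntegralCLM ENNReal.ofReal_ne_top hQle s
    obtain ⟨J, hJ⟩ := exists_setIntegralCLM ENNReal.one_ne_top hPle s
    -- Both sides are continuous functionals of `X`.
    have : J.comp hc = ψ := clm_eq_of_eventLp fun t ht => by
      rw [ContinuousLinearMap.comp_apply, hJ, hψ]
      change ∫ ω in s, h (eventLp P ht) ω ∂P = _
      rw [hh.setIntegral_eventLp hs ht, ← hQreal]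
      have h1 : (eventLp P ht : Ω → ℝ) =ᵐ[Q] t.indicator fun _ => 1 :=
        hac.ae_le indicatorConstLp_coeFn
      rw [integral_congr_ae (ae_restrict_of_ae h1), setIntegral_indicator ht]
      simp
    rw [← hψ, ← this, ContinuousLinearMap.comp_apply, hJ]
    rfl
  refine ⟨Q, hcomp, fun X => ⟨hint X, ?_⟩⟩
  obtain ⟨g, hg, hXg⟩ := hh.generatedIn X
  have hgP : Integrable g P := (L1.integrable_coeFn (h X)).congr hXg
  have hgQ : Integrable g Q := integrable_of_integrable_trim G.2 (by
    rw [hcomp.2.2]; exact hgP.trim G.2 hg)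
  refine hXg.trans (ae_eq_of_ae_eq_of_mem_compatibleMeasures hcomp hg stronglyMeasurable_condExp ?_)
  refine ae_eq_condExp_of_forall_setIntegral_eq G.2 (hint X) (fun _ _ _ => hgQ.integrableOn)
    (fun s hs _ => ?_) hg.aestronglyMeasurable
  rw [← hset s hs X, setIntegral_trim G.2 hg hs, hcomp.2.2, ← setIntegral_trim G.2 hg hs]
  exact setIntegral_congr_ae (G.2 s hs) (hXg.mono fun ω hω _ => hω.symm)

end AllocationMechanism

end

open AllocationMechanism in
theorem proposition2 {Ω : Type*} [MeasurableSpace Ω] (P : Measure Ω) [IsProbabilityMeasure P]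
    (n : ℕ) (hn : 3 ≤ n) (H : AllocationMechanism.Mechanism P n) :
    (AllocationMechanism.IsAllocationMechanism H ∧
      AllocationMechanism.InternalFairness H ∧
      AllocationMechanism.AgentAnonymity H ∧
      AllocationMechanism.OperationalAnonymity H ∧
      AllocationMechanism.FrictionlessParticipation H ∧
      AllocationMechanism.ScaleInvariance H ∧
      AllocationMechanism.AllocationProperties H) ↔
    ∃ Q : AllocationMechanism.Endowment P → AllocationMechanism.SubSigma Ω → Measure Ω,
      AllocationMechanism.IsConditionalMeanMechanism H Q ∧
      ∀ (S : AllocationMechanism.Endowment P) (G : AllocationMechanism.SubSigma Ω),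
        Q S G ∈ AllocationMechanism.compatibleMeasures P (AllocationMechanism.augment G S) := by
  constructor
  · rintro ⟨-, hIF, hAA, hOA, hFP, hSI, hZP, hIA, hIB, -⟩
    choose h hh hH using exists_condExpOperator hn hIF hAA hOA hFP hSI hZP hIA hIB
    choose Q hQ hQh using fun S G => (hh S G).exists_measure
    refine ⟨Q, ⟨fun S G => (hQ S G).1, fun X G i => ?_⟩, hQ⟩
    rw [hH (aggregate X) G X rfl i]
    exact hQh (aggregate X) G (X i)
  · rintro ⟨Q, ⟨-, hH⟩, hQ⟩
    let a : Fin n := ⟨0, by omega⟩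
    let b : Fin n := ⟨1, by omega⟩
    have hab : a ≠ b := by simp [a, b]
    -- Every integrable `Y` is the endowment of an agent in an allocation of `S`.
    have key : ∀ S G (Y : Endowment P), Integrable (Y : Ω → ℝ) (Q S G) ∧
        (H (Pi.single a Y + Pi.single b (S - Y)) G a : Ω → ℝ) =ᵐ[P]
          condExp (augment G S).1 (Q S G) (Y : Ω → ℝ) := fun S G Y => by
      have hagg : aggregate (Pi.single a Y + Pi.single b (S - Y)) = S := by
        rw [aggregate_add, aggregate_single, aggregate_single, add_sub_cancel]
      have hYa : (Pi.single a Y + Pi.single b (S - Y) : Fin n → Endowment P) a = Y := by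
        simp [hab]
      have := hH (Pi.single a Y + Pi.single b (S - Y)) G a
      rwa [hagg, hYa] at this
    choose h hh hk using fun S G => exists_condExpOperator_of_condExp (hQ S G)
      (fun Y => (key S G Y).1) (fun Y => (key S G Y).2)
    refine axioms_of_condExpOperator hh fun X G i => Lp.ext ?_
    rw [hk]
    exact (hH X G i).2.trans (key _ G (X i)).2.symm
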